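/- Let $\mathbb{U}^*=\{\zeta\in\mathbb{C}:|\zeta|>1\}$. Let $\Sigma$ be the class of all functions $f$ meromorphic in $\mathbb{U}^*$ that have an expansion $f(\zeta)=b\zeta+b_0+\dfrac{b_1}{\zeta}+\dfrac{b_2}{\zeta^2}+\cdots$ with complex coefficients, valid for all sufficiently large $|\zeta|$ (in particular, all functions analytic in $\mathbb{U}^*$ for which such an expansion holds throughout $\mathbb{U}^*$). A meromorphic function is called univalent on a set if it is injective there as a map into the Riemann sphere $\mathbb{C}\cup\{\infty\}$, and locally univalent in $\mathbb{U}^*$ if every point of $\mathbb{U}^*$ has a neighbourhood on which it is univalent. Let $f\in\Sigma$ be locally univalent in $\mathbb{U}^*$. If $$(|\zeta|^2-1)\left|\frac{\zeta f''(\zeta)}{f'(\zeta)}\right|\le 1$$ for all $\zeta\in\mathbb{U}^*$ that are not poles of $f$, then $f$ is univalent in $\mathbb{U}^*$. -/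

import Mathlib

open Topology

noncomputable section

/-- The exterior `ℂ ∖ closure 𝕌` of the closed unit disk. -/
def exteriorDisk : Set ℂ := (closure (Metric.ball (0 : ℂ) 1))ᶜ

/-- `ζ` is a pole of `f` (for `f` meromorphic at `ζ`). -/
def IsPole (f : ℂ → ℂ) (ζ : ℂ) : Prop := meromorphicOrderAt f ζ < 0

open Classical in
/-- A meromorphic function viewed as a map into the Riemann sphere, with value `∞` at its
poles. -/
def toSphere (f : ℂ → ℂ) (ζ : ℂ) : OnePoint ℂ :=
  if IsPole f ζ then OnePoint.infty else (f ζ : OnePoint ℂ)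

/-- The class `Σ`: functions meromorphic in the exterior disk with an expansion
`f(ζ) = b ζ + b₀ + b₁ / ζ + ⋯` at infinity. `MeromorphicNFOn` (meromorphic in normal form) says
that `f` is meromorphic and carries its true value at each point which is not a pole (no
arbitrary values at removable singularities). -/
def ClassSigma : Set (ℂ → ℂ) :=
  {f | MeromorphicNFOn f exteriorDisk ∧
    ∃ (b : ℂ) (c : ℕ → ℂ) (R : ℝ), ∀ ζ : ℂ, R < ‖ζ‖ →
      HasSum (fun n : ℕ => c n / ζ ^ n) (f ζ - b * ζ)}

/-- Univalence of a meromorphic function: injectivity as a map into the Riemann sphere. -/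
def IsUnivalentOn (f : ℂ → ℂ) (U : Set ℂ) : Prop := Set.InjOn (toSphere f) U

/-- Local univalence: every point of `U` has a neighbourhood on which `f` is univalent. -/
def IsLocallyUnivalentOn (f : ℂ → ℂ) (U : Set ℂ) : Prop :=
  ∀ ζ ∈ U, ∃ V ∈ 𝓝 ζ, IsUnivalentOn f V

end

/-! The bound makes `f''/f'` locally bounded. At a pole or a critical point `f'` would have nonzero
order and its logarithmic derivative a simple pole, so neither occurs. In the variable z = 1/ζ, f(ζ)
= bζ + h(z) with h holomorphic in the disk, f' = b - z²h', f'' = z³(2h' + zh''), and the bound reads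
(1-|z|²)|2h' + zh''| ≤ |b - z²h'|.

If the inequality is strict and h is holomorphic past the circle, `beckerExtension` is a C¹ map F of
the whole plane. The two sides of the inequality are then |∂F/∂w̄| and |∂F/∂w| inside the disk, so F
is a local homeomorphism. Since F - bw is bounded and b ≠ 0, F is proper, and a far away value has a
single preimage. A clopen argument makes F injective (`injOn_of_becker_strict`). Rescaling the
variable yields the strict case from the weak one (`injOn_of_becker`). -/

/-! ### Proper local homeomorphisms and planar maps of positive Jacobian -/

/-- A proper local homeomorphism with connected Hausdorff target and some fibre with at most one
point is injective: its set of double values is clopen. -/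
theorem IsLocalHomeomorph.injective_of_isProperMap {X Y : Type*} [TopologicalSpace X]
    [TopologicalSpace Y] [T2Space X] [T2Space Y] [PreconnectedSpace Y] {F : X → Y}
    (hF : IsLocalHomeomorph F) (hp : IsProperMap F) {y₀ : Y}
    (hy₀ : ∀ x x', F x = y₀ → F x' = y₀ → x = x') : Function.Injective F := by
  set A : Set Y := {y | ∃ x x', x ≠ x' ∧ F x = y ∧ F x' = y} with hA
  have hopen : IsOpen A := by
    rw [isOpen_iff_mem_nhds]
    rintro y ⟨x, x', hne, hx, hx'⟩
    obtain ⟨U, V, hU, hV, hxU, hxV, hd⟩ := t2_separation hne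
    filter_upwards [(hF.isOpenMap U hU).mem_nhds ⟨x, hxU, hx⟩,
      (hF.isOpenMap V hV).mem_nhds ⟨x', hxV, hx'⟩]
    rintro z ⟨u, hu, rfl⟩ ⟨v, hv, hvz⟩
    exact ⟨u, v, fun h ↦ Set.disjoint_left.1 hd hu (h ▸ hv), rfl, hvz⟩
  have hclosed : IsClosed A := by
    -- Local injectivity keeps pairs of double points away from the diagonal. Properness of F × F
    -- makes their image closed, and `A` is the trace of that image on the diagonal.
    have hD : IsClosed {p : X × X | p.1 ≠ p.2 ∧ F p.1 = F p.2} := by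
      rw [← isOpen_compl_iff, isOpen_iff_mem_nhds]
      rintro ⟨x, x'⟩ hxx
      by_cases h : F x = F x'
      · have hxx' : x = x' := by
          by_contra hne
          exact hxx ⟨hne, h⟩
        subst hxx'
        obtain ⟨U, hU, hxU, hinj⟩ := hF.isLocallyInjective x
        filter_upwards [(hU.prod hU).mem_nhds ⟨hxU, hxU⟩]
        rintro ⟨u, v⟩ ⟨hu, hv⟩ ⟨hne, he⟩
        exact hne (hinj hu hv he)
      · have : IsOpen {p : X × X | F p.1 ≠ F p.2} :=
          isOpen_ne_fun (hF.continuous.comp continuous_fst) (hF.continuous.comp continuous_snd)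
        filter_upwards [this.mem_nhds h] with p hpp hq
        exact hpp hq.2
    have := ((hp.prodMap hp).isClosedMap _ hD).preimage
      (continuous_id.prodMk continuous_id : Continuous fun y : Y ↦ (y, y))
    convert this using 1
    ext y
    constructor
    · rintro ⟨x, x', hne, hx, hx'⟩
      exact ⟨(x, x'), ⟨hne, hx.trans hx'.symm⟩, Prod.ext hx hx'⟩
    · rintro ⟨⟨x, x'⟩, ⟨hne, -⟩, he⟩
      exact ⟨x, x', hne, congrArg Prod.fst he, congrArg Prod.snd he⟩
  have hempty : A = ∅ := by
    rcases isClopen_iff.1 ⟨hclosed, hopen⟩ with h | h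
    · exact h
    · obtain ⟨x, x', hne, hx, hx'⟩ : y₀ ∈ A := h ▸ Set.mem_univ _
      exact absurd (hy₀ x x' hx hx') hne
  intro x x' h
  by_contra hne
  have : F x' ∈ A := ⟨x, x', hne, h, rfl⟩
  simp [hempty] at this

/-- The real-linear map `v ↦ a v + b v̄` of the complex plane. -/
noncomputable def Complex.mulAddConjCLM (a b : ℂ) : ℂ →L[ℝ] ℂ :=
  a • (ContinuousLinearMap.id ℝ ℂ) + b • (Complex.conjCLE : ℂ →L[ℝ] ℂ)

theorem Complex.mulAddConjCLM_apply (a b v : ℂ) :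
    Complex.mulAddConjCLM a b v = a * v + b * (starRingEnd ℂ) v := by
  simp [mulAddConjCLM]

/-- The real determinant is |a|² - |b|²; here a kernel vector v ≠ 0 would force |a||v| = |b||v|. -/
theorem Complex.exists_equiv_mulAddConjCLM {a b : ℂ} (h : ‖b‖ < ‖a‖) :
    ∃ e : ℂ ≃L[ℝ] ℂ, (e : ℂ →L[ℝ] ℂ) = Complex.mulAddConjCLM a b := by
  have hinj : Function.Injective (Complex.mulAddConjCLM a b) := by
    rw [injective_iff_map_eq_zero]
    intro v hv
    rw [Complex.mulAddConjCLM_apply] at hv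
    by_contra hv0
    have h1 : ‖a‖ * ‖v‖ = ‖b‖ * ‖v‖ := by
      have := congrArg norm (eq_neg_of_add_eq_zero_left hv)
      simpa using this
    exact h.ne' (mul_right_cancel₀ (norm_ne_zero_iff.2 hv0) h1)
  refine ⟨(LinearEquiv.ofInjectiveEndo (Complex.mulAddConjCLM a b).toLinearMap
    hinj).toContinuousLinearEquiv, ?_⟩
  ext v
  rfl

/-- A `C¹` map of the plane with everywhere positive Jacobian is a local homeomorphism. -/
theorem Complex.isLocalHomeomorph_of_hasFDerivAt {F A B : ℂ → ℂ}
    (hF : ∀ w, HasFDerivAt F (Complex.mulAddConjCLM (A w) (B w)) w)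
    (hA : Continuous A) (hB : Continuous B) (hAB : ∀ w, ‖B w‖ < ‖A w‖) :
    IsLocalHomeomorph F := by
  refine IsLocalHomeomorph.mk F fun w ↦ ?_
  obtain ⟨e, he⟩ := Complex.exists_equiv_mulAddConjCLM (hAB w)
  have hs : HasStrictFDerivAt F (e : ℂ →L[ℝ] ℂ) w := by
    rw [he]
    refine hasStrictFDerivAt_of_hasFDerivAt_of_continuousAt (Filter.Eventually.of_forall hF) ?_
    unfold Complex.mulAddConjCLM
    fun_prop
  exact ⟨hs.toOpenPartialHomeomorph F, hs.mem_toOpenPartialHomeomorph_source, fun _ _ ↦ rfl⟩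

/-! ### Bounded logarithmic derivatives -/

/-- If `u = (z - z₀) ^ m g` with `g` analytic and nonvanishing at `z₀`, and the logarithmic
derivative of `u` is bounded near `z₀`, then `m = 0`. -/
theorem zpow_exponent_eq_zero_of_logDeriv_bounded {u g : ℂ → ℂ} {z₀ : ℂ} {m : ℤ} {C : ℝ}
    (hg : AnalyticAt ℂ g z₀) (hg0 : g z₀ ≠ 0)
    (hu : u =ᶠ[𝓝[≠] z₀] fun z ↦ (z - z₀) ^ m * g z)
    (hC : ∀ᶠ z in 𝓝[≠] z₀, ‖logDeriv u z‖ ≤ C) : m = 0 := by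
  -- The exponent m is the residue of the logarithmic derivative: the left side tends to 0, the
  -- right side to m.
  have h1 : ∀ᶠ z in 𝓝[≠] z₀, (z - z₀) * logDeriv u z = m + (z - z₀) * (deriv g z / g z) := by
    filter_upwards [logDeriv_congr_nhdsNE hu, self_mem_nhdsWithin,
      nhdsWithin_le_nhds (hg.continuousAt.eventually_ne hg0),
      nhdsWithin_le_nhds hg.eventually_analyticAt] with z hz hne hgz hgan
    have hne' : z - z₀ ≠ 0 := sub_ne_zero.2 hne
    have hdz : DifferentiableAt ℂ (fun z ↦ (z - z₀) ^ m) z :=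
      DifferentiableAt.zpow (by fun_prop) (Or.inl hne')
    rw [hz, logDeriv_mul (f := fun z ↦ (z - z₀) ^ m) z (zpow_ne_zero m hne') hgz hdz hgan.differentiableAt,
      logDeriv_fun_zpow (by fun_prop)]
    have : logDeriv (fun x ↦ x - z₀) z = 1 / (z - z₀) := by
      simp [logDeriv_apply]
    rw [this, logDeriv_apply]
    field_simp
  have hz : Filter.Tendsto (fun z : ℂ ↦ z - z₀) (𝓝[≠] z₀) (𝓝 0) := by
    have : Filter.Tendsto (fun z : ℂ ↦ z - z₀) (𝓝 z₀) (𝓝 (z₀ - z₀)) :=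
      (continuous_id.sub continuous_const).tendsto z₀
    rw [sub_self] at this
    exact this.mono_left nhdsWithin_le_nhds
  have h2 : Filter.Tendsto (fun z ↦ (z - z₀) * logDeriv u z) (𝓝[≠] z₀) (𝓝 0) :=
    hz.zero_mul_isBoundedUnder_le ⟨C, by simpa using hC⟩
  have h3 : Filter.Tendsto (fun z ↦ (m : ℂ) + (z - z₀) * (deriv g z / g z)) (𝓝[≠] z₀)
      (𝓝 (m + 0 * (deriv g z₀ / g z₀))) :=
    tendsto_const_nhds.add (hz.mul
      ((hg.deriv.continuousAt.div hg.continuousAt hg0).tendsto.mono_left nhdsWithin_le_nhds))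
  have := tendsto_nhds_unique (h2.congr' h1) h3
  simpa using this.symm

/-! ### Extension across the unit circle and the strict criterion -/

/-- Complex conjugation inside the closed unit disk, inversion outside of it. -/
noncomputable def conjOrInv (w : ℂ) : ℂ :=
  open Classical in if ‖w‖ ≤ 1 then (starRingEnd ℂ) w else w⁻¹

theorem conjOrInv_of_le {w : ℂ} (hw : ‖w‖ ≤ 1) : conjOrInv w = (starRingEnd ℂ) w := if_pos hw

theorem conjOrInv_of_ge {w : ℂ} (hw : 1 ≤ ‖w‖) : conjOrInv w = w⁻¹ := by
  rcases hw.eq_or_lt with h | h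
  · rw [conjOrInv_of_le h.ge, Complex.inv_def, Complex.normSq_eq_norm_sq, ← h]
    simp
  · exact if_neg h.not_ge

theorem norm_conjOrInv_le (w : ℂ) : ‖conjOrInv w‖ ≤ 1 := by
  rcases le_total ‖w‖ 1 with h | h
  · simpa [conjOrInv_of_le h] using h
  · simpa [conjOrInv_of_ge h] using inv_le_one_of_one_le₀ h

theorem continuous_conjOrInv : Continuous conjOrInv := by
  rw [← continuousOn_univ]
  have hc : IsClosed {w : ℂ | ‖w‖ ≤ 1} := isClosed_le continuous_norm continuous_const
  have hd : IsClosed {w : ℂ | 1 ≤ ‖w‖} := isClosed_le continuous_const continuous_norm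
  have hu : (Set.univ : Set ℂ) = {w : ℂ | ‖w‖ ≤ 1} ∪ {w : ℂ | 1 ≤ ‖w‖} := by
    ext w
    simpa using le_total ‖w‖ 1
  rw [hu]
  refine ContinuousOn.union_of_isClosed ?_ ?_ hc hd
  · exact Complex.continuous_conj.continuousOn.congr fun w hw ↦ conjOrInv_of_le hw
  · refine ContinuousOn.congr (f := fun w : ℂ ↦ w⁻¹) ?_ fun w hw ↦ conjOrInv_of_ge hw
    refine continuousOn_id.inv₀ fun w hw ↦ ?_
    rintro rfl
    simp at hw
    linarith

theorem norm_one_sub_mul_conjOrInv_le (w : ℂ) : ‖1 - w * conjOrInv w‖ ≤ 1 := by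
  rcases le_total ‖w‖ 1 with h | h
  · rw [conjOrInv_of_le h, Complex.mul_conj, Complex.normSq_eq_norm_sq, ← Complex.ofReal_one,
      ← Complex.ofReal_sub, Complex.norm_real, Real.norm_eq_abs, abs_le]
    constructor <;> nlinarith [norm_nonneg w]
  · have : w ≠ 0 := by
      rintro rfl
      simp at h
      linarith
    simp [conjOrInv_of_ge h, mul_inv_cancel₀ this]

/-- The extension to the plane of `w ↦ b w + h (1 / w)`, `1 ≤ ‖w‖`. -/
noncomputable def beckerExtension (b : ℂ) (h : ℂ → ℂ) (w : ℂ) : ℂ :=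
  b * w + h (conjOrInv w) + conjOrInv w * (1 - w * conjOrInv w) * deriv h (conjOrInv w)

theorem beckerExtension_of_ge (b : ℂ) (h : ℂ → ℂ) {w : ℂ} (hw : 1 ≤ ‖w‖) :
    beckerExtension b h w = b * w + h w⁻¹ := by
  have : w ≠ 0 := by
    rintro rfl
    simp at hw
    linarith
  simp [beckerExtension, conjOrInv_of_ge hw, mul_inv_cancel₀ this]

section

variable {b : ℂ} {h : ℂ → ℂ} {ρ : ℝ}

/-- Each closed side is differentiated separately. On the circle w̄ = 1/w and 1 - ww̄ = 0, so both
derivatives are given by the same formula there. -/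
theorem hasFDerivAt_beckerExtension (hρ : 1 < ρ)
    (hh : DifferentiableOn ℂ h (Metric.ball 0 ρ)) (w : ℂ) :
    HasFDerivAt (beckerExtension b h) (Complex.mulAddConjCLM
      (b - conjOrInv w ^ 2 * deriv h (conjOrInv w))
      ((1 - w * conjOrInv w) *
        (2 * deriv h (conjOrInv w) + conjOrInv w * deriv (deriv h) (conjOrInv w)))) w := by
  have hd : ∀ z : ℂ, ‖z‖ ≤ 1 → HasDerivAt h (deriv h z) z ∧
      HasDerivAt (deriv h) (deriv (deriv h) z) z := fun z hz ↦ by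
    have hz' : Metric.ball (0 : ℂ) ρ ∈ 𝓝 z :=
      Metric.isOpen_ball.mem_nhds (by simpa using hz.trans_lt hρ)
    exact ⟨(hh.differentiableAt hz').hasDerivAt,
      ((hh.deriv Metric.isOpen_ball).differentiableAt hz').hasDerivAt⟩
  have hu : (Set.univ : Set ℂ) = {w : ℂ | ‖w‖ ≤ 1} ∪ {w : ℂ | 1 ≤ ‖w‖} := by
    ext w
    simpa using le_total ‖w‖ 1
  rw [← hasFDerivWithinAt_univ, hu]
  have hc : IsClosed {w : ℂ | ‖w‖ ≤ 1} := isClosed_le continuous_norm continuous_const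
  have hd' : IsClosed {w : ℂ | 1 ≤ ‖w‖} := isClosed_le continuous_const continuous_norm
  refine HasFDerivWithinAt.union ?_ ?_
  · by_cases hw : ‖w‖ ≤ 1
    · rw [conjOrInv_of_le hw]
      obtain ⟨h1, h2⟩ := hd ((starRingEnd ℂ) w) (by simpa using hw)
      have hconj : HasFDerivAt (fun w : ℂ ↦ (starRingEnd ℂ) w) (Complex.conjCLE : ℂ →L[ℝ] ℂ) w :=
        Complex.conjCLE.hasFDerivAt
      have hid : HasFDerivAt (fun w : ℂ ↦ w) (ContinuousLinearMap.id ℝ ℂ) w := hasFDerivAt_id w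
      have e1 := (h1.hasFDerivAt.restrictScalars ℝ).comp w hconj
      have e2 := (h2.hasFDerivAt.restrictScalars ℝ).comp w hconj
      have e := ((hid.const_mul b).add e1).add
        ((hconj.mul ((hid.mul hconj).const_sub 1)).mul e2)
      refine (e.hasFDerivWithinAt.congr (f₁ := beckerExtension b h) (s := {w : ℂ | ‖w‖ ≤ 1})
        (fun v hv ↦ ?_) ?_).congr_fderiv ?_
      · simp [beckerExtension, conjOrInv_of_le hv]
      · simp [beckerExtension, conjOrInv_of_le hw]
      · refine ContinuousLinearMap.ext fun v ↦ ?_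
        rw [Complex.mulAddConjCLM_apply]
        simp
        ring
    -- Off the closed side, every linear map is a derivative within it.
    · refine HasFDerivWithinAt.of_notMem_closure ?_
      rwa [hc.closure_eq]
  · by_cases hw : 1 ≤ ‖w‖
    · have hw0 : w ≠ 0 := by
        rintro rfl
        simp at hw
        linarith
      rw [conjOrInv_of_ge hw]
      obtain ⟨h1, -⟩ := hd w⁻¹ (by simpa using inv_le_one_of_one_le₀ hw)
      have e := (((hasDerivAt_id w).const_mul b).add
        (h1.comp w (hasDerivAt_inv hw0))).hasFDerivAt.restrictScalars ℝ
      refine (e.hasFDerivWithinAt.congr (f₁ := beckerExtension b h) (s := {w : ℂ | 1 ≤ ‖w‖})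
        (fun v hv ↦ ?_) ?_).congr_fderiv ?_
      · simp [beckerExtension_of_ge b h hv]
      · simp [beckerExtension_of_ge b h hw]
      · refine ContinuousLinearMap.ext fun v ↦ ?_
        rw [Complex.mulAddConjCLM_apply]
        simp [mul_inv_cancel₀ hw0]
        ring
    · refine HasFDerivWithinAt.of_notMem_closure ?_
      rwa [hd'.closure_eq]

/-- Becker's criterion for `b w + h (1 / w)` with `h` holomorphic beyond the closed unit disk. -/
theorem injOn_of_becker_strict (hρ : 1 < ρ) (hh : DifferentiableOn ℂ h (Metric.ball 0 ρ))
    (hlt : ∀ z : ℂ, ‖z‖ ≤ 1 →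
      (1 - ‖z‖ ^ 2) * ‖2 * deriv h z + z * deriv (deriv h) z‖ < ‖b - z ^ 2 * deriv h z‖) :
    Set.InjOn (fun w ↦ b * w + h w⁻¹) {w : ℂ | 1 ≤ ‖w‖} := by
  have hb : 0 < ‖b‖ := by
    have := hlt 0 (by simp)
    simp only [norm_zero, zero_mul, add_zero, ne_eq, OfNat.ofNat_ne_zero, not_false_eq_true,
      zero_pow, sub_zero, one_mul] at this
    exact (norm_nonneg _).trans_lt this
  have hsub : Metric.closedBall (0 : ℂ) 1 ⊆ Metric.ball 0 ρ := Metric.closedBall_subset_ball hρ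
  have hh1 := hh.deriv Metric.isOpen_ball
  have hh2 := hh1.deriv Metric.isOpen_ball
  have hcomp : ∀ g : ℂ → ℂ, DifferentiableOn ℂ g (Metric.ball 0 ρ) →
      Continuous fun w ↦ g (conjOrInv w) := fun g hg ↦
    hg.continuousOn.comp_continuous continuous_conjOrInv
      fun w ↦ hsub (by simpa using norm_conjOrInv_le w)
  have hbdd : ∀ g : ℂ → ℂ, DifferentiableOn ℂ g (Metric.ball 0 ρ) →
      ∃ C, 0 ≤ C ∧ ∀ z : ℂ, ‖z‖ ≤ 1 → ‖g z‖ ≤ C := fun g hg ↦ by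
    obtain ⟨C, hC⟩ := (isCompact_closedBall (0 : ℂ) 1).exists_bound_of_continuousOn
      (hg.continuousOn.mono hsub)
    have hC' : ∀ z : ℂ, ‖z‖ ≤ 1 → ‖g z‖ ≤ C := fun z hz ↦ hC z (by simpa using hz)
    exact ⟨C, (norm_nonneg _).trans (hC' 0 (by simp)), hC'⟩
  have hloc : IsLocalHomeomorph (beckerExtension b h) := by
    refine Complex.isLocalHomeomorph_of_hasFDerivAt
      (hasFDerivAt_beckerExtension (b := b) hρ hh) ?_ ?_ fun w ↦ ?_
    · exact continuous_const.sub ((continuous_conjOrInv.pow 2).mul (hcomp _ hh1))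
    · exact (continuous_const.sub (continuous_id.mul continuous_conjOrInv)).mul
        ((continuous_const.mul (hcomp _ hh1)).add (continuous_conjOrInv.mul (hcomp _ hh2)))
    · refine lt_of_le_of_lt ?_ (hlt _ (norm_conjOrInv_le w))
      rw [norm_mul]
      rcases le_total ‖w‖ 1 with hw | hw
      · have : ‖1 - w * conjOrInv w‖ = 1 - ‖conjOrInv w‖ ^ 2 := by
          rw [conjOrInv_of_le hw, Complex.mul_conj, Complex.normSq_eq_norm_sq,
            ← Complex.ofReal_one, ← Complex.ofReal_sub, Complex.norm_real, Real.norm_eq_abs,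
            RCLike.norm_conj, abs_of_nonneg (by nlinarith [norm_nonneg w])]
        rw [this]
      · have hw0 : w ≠ 0 := by
          rintro rfl
          simp at hw
          linarith
        have h1 := norm_conjOrInv_le w
        rw [show 1 - w * conjOrInv w = 0 by simp [conjOrInv_of_ge hw, mul_inv_cancel₀ hw0]]
        have h2 : 0 ≤ 1 - ‖conjOrInv w‖ ^ 2 := by nlinarith [norm_nonneg (conjOrInv w)]
        simpa using mul_nonneg h2 (norm_nonneg _)
  obtain ⟨C₀, hC₀, hb₀⟩ := hbdd h hh
  obtain ⟨C₁, hC₁, hb₁⟩ := hbdd _ hh1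
  have hdist : ∀ w, ‖beckerExtension b h w - b * w‖ ≤ C₀ + C₁ := fun w ↦ by
    have hs := norm_conjOrInv_le w
    have : beckerExtension b h w - b * w = h (conjOrInv w) +
        conjOrInv w * (1 - w * conjOrInv w) * deriv h (conjOrInv w) := by
      unfold beckerExtension
      ring
    rw [this]
    refine (norm_add_le _ _).trans (add_le_add (hb₀ _ hs) ?_)
    rw [norm_mul, norm_mul]
    calc _ ≤ 1 * 1 * C₁ := by
          gcongr
          · exact norm_one_sub_mul_conjOrInv_le w
          · exact hb₁ _ hs
      _ = C₁ := by ring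
  have hproper : IsProperMap (beckerExtension b h) := by
    rw [isProperMap_iff_tendsto_cocompact]
    refine ⟨hloc.continuous, ?_⟩
    rw [← Metric.cobounded_eq_cocompact, ← tendsto_norm_atTop_iff_cobounded]
    have h1 : Filter.Tendsto (fun w : ℂ ↦ ‖b‖ * ‖w‖ - (C₀ + C₁)) (Bornology.cobounded ℂ)
        Filter.atTop :=
      Filter.tendsto_atTop_add_const_right _ _ (tendsto_norm_cobounded_atTop.const_mul_atTop hb)
    refine Filter.tendsto_atTop_mono (fun w ↦ ?_) h1
    have h2 := norm_sub_norm_le (b * w) (b * w - beckerExtension b h w)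
    rw [sub_sub_cancel, norm_sub_rev (b * w), norm_mul] at h2
    linarith [hdist w]
  -- Chosen so that |b|T = |b| + C₁: for |w|, |w'| ≥ T the variation of h(1/w) is too small to
  -- offset b(w - w').
  set T : ℝ := 1 + C₁ / ‖b‖ with hT
  have hT1 : 1 ≤ T := by
    have : 0 ≤ C₁ / ‖b‖ := by positivity
    linarith
  -- As |F(w)| ≤ |b||w| + C₀ + C₁, a value of this modulus is only attained where |w| ≥ T.
  have hfib : ∀ w w', beckerExtension b h w = ((C₀ + C₁ + ‖b‖ * T : ℝ) : ℂ) →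
      beckerExtension b h w' = ((C₀ + C₁ + ‖b‖ * T : ℝ) : ℂ) → w = w' := by
    have hlarge : ∀ w, beckerExtension b h w = ((C₀ + C₁ + ‖b‖ * T : ℝ) : ℂ) → T ≤ ‖w‖ := by
      intro w hw
      have h2 := norm_sub_norm_le (beckerExtension b h w) (b * w)
      have h3 : ‖beckerExtension b h w‖ = C₀ + C₁ + ‖b‖ * T := by
        rw [hw, Complex.norm_real, Real.norm_of_nonneg (by positivity)]
      rw [h3, norm_mul] at h2
      have h4 := hdist w
      exact le_of_mul_le_mul_left (by linarith) hb
    intro w w' hw hw'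
    have hwT := hlarge w hw
    have hwT' := hlarge w' hw'
    have hw0 : w ≠ 0 := norm_pos_iff.1 (by linarith)
    have hw0' : w' ≠ 0 := norm_pos_iff.1 (by linarith)
    have heq := hw.trans hw'.symm
    rw [beckerExtension_of_ge b h (hT1.trans hwT), beckerExtension_of_ge b h (hT1.trans hwT')]
      at heq
    have hinv : ∀ v : ℂ, T ≤ ‖v‖ → v⁻¹ ∈ Metric.closedBall (0 : ℂ) 1 := fun v hv ↦ by
      simpa using inv_le_one_of_one_le₀ (hT1.trans hv)
    have hlip : ‖h w'⁻¹ - h w⁻¹‖ ≤ C₁ * ‖w'⁻¹ - w⁻¹‖ := by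
      refine (convex_closedBall (0 : ℂ) 1).norm_image_sub_le_of_norm_deriv_le
        (fun z hz ↦ hh.differentiableAt (Metric.isOpen_ball.mem_nhds (hsub hz)))
        (fun z hz ↦ hb₁ z (by simpa using hz)) (hinv w hwT) (hinv w' hwT')
    have hbw : ‖b‖ * ‖w - w'‖ = ‖h w'⁻¹ - h w⁻¹‖ := by
      rw [← norm_mul]
      congr 1
      linear_combination heq
    have hii : ‖w'⁻¹ - w⁻¹‖ = ‖w - w'‖ / (‖w'‖ * ‖w‖) := by
      rw [inv_sub_inv hw0' hw0, norm_div, norm_mul]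
    rw [← hbw, hii] at hlip
    by_contra hne
    have hpos : 0 < ‖w - w'‖ := norm_pos_iff.2 (sub_ne_zero.2 hne)
    have hTT : T ≤ ‖w'‖ * ‖w‖ := by nlinarith
    have h5 : C₁ * (‖w - w'‖ / (‖w'‖ * ‖w‖)) ≤ C₁ * (‖w - w'‖ / T) := by gcongr
    have h6 : ‖b‖ * ‖w - w'‖ * T ≤ C₁ * ‖w - w'‖ := by
      have := hlip.trans h5
      rwa [← mul_div_assoc, le_div_iff₀ (by linarith)] at this
    have h7 : ‖b‖ * T = ‖b‖ + C₁ := by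
      rw [hT]
      field_simp
    nlinarith
  have hinj := hloc.injective_of_isProperMap hproper hfib
  intro w hw w' hw' he
  refine hinj ?_
  rw [beckerExtension_of_ge b h hw, beckerExtension_of_ge b h hw']
  exact he

end

/-! ### Absence of poles and critical points -/

/-- An analytic function with locally bounded logarithmic derivative has no isolated zero. -/
theorem AnalyticAt.ne_zero_of_logDeriv_bounded {u : ℂ → ℂ} {z₀ : ℂ} {C : ℝ}
    (hu : AnalyticAt ℂ u z₀) (hne : ¬ ∀ᶠ z in 𝓝 z₀, u z = 0)
    (hC : ∀ᶠ z in 𝓝[≠] z₀, ‖logDeriv u z‖ ≤ C) : u z₀ ≠ 0 := by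
  obtain ⟨n, g, hg, hg0, hug⟩ := hu.exists_eventuallyEq_pow_smul_nonzero_iff.2 hne
  have hn : (n : ℤ) = 0 := by
    refine zpow_exponent_eq_zero_of_logDeriv_bounded hg hg0 ?_ hC
    filter_upwards [nhdsWithin_le_nhds hug] with z hz
    simpa using hz
  rw [hug.self_of_nhds]
  simpa [Int.natCast_eq_zero.1 hn] using hg0

theorem mem_exteriorDisk {ζ : ℂ} : ζ ∈ exteriorDisk ↔ 1 < ‖ζ‖ := by
  simp [exteriorDisk, closure_ball (0 : ℂ) one_ne_zero]

theorem isOpen_exteriorDisk : IsOpen exteriorDisk := isClosed_closure.isOpen_compl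

theorem inv_mem_exteriorDisk {z : ℂ} (hz0 : z ≠ 0) (hz : ‖z‖ < 1) : z⁻¹ ∈ exteriorDisk := by
  rw [mem_exteriorDisk, norm_inv]
  exact (one_lt_inv₀ (norm_pos_iff.2 hz0)).2 hz

theorem AnalyticAt.not_isPole {f : ℂ → ℂ} {ζ : ℂ} (hf : AnalyticAt ℂ f ζ) : ¬ IsPole f ζ :=
  not_lt.2 hf.meromorphicOrderAt_nonneg

theorem toSphere_of_not_isPole {f : ℂ → ℂ} {ζ : ℂ} (hf : ¬ IsPole f ζ) :
    toSphere f ζ = (f ζ : OnePoint ℂ) := if_neg hf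

theorem IsLocallyUnivalentOn.not_eventuallyEq_const {f : ℂ → ℂ} {U : Set ℂ}
    (hloc : IsLocallyUnivalentOn f U) {ζ : ℂ} (hζ : ζ ∈ U) (c : ℂ) :
    ¬ ∀ᶠ z in 𝓝 ζ, f z = c := by
  intro h
  obtain ⟨V, hV, hinj⟩ := hloc ζ hζ
  have hs : ∀ᶠ z in 𝓝 ζ, toSphere f z = (c : OnePoint ℂ) := by
    filter_upwards [eventually_eventually_nhds.2 h] with z hz
    rw [toSphere_of_not_isPole, hz.self_of_nhds]
    exact ((analyticAt_congr hz).2 analyticAt_const).not_isPole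
  have hev : ∀ᶠ z in 𝓝[≠] ζ, (z ∈ V ∧ toSphere f z = (c : OnePoint ℂ)) ∧ z ≠ ζ :=
    ((Filter.Eventually.and hV hs).filter_mono nhdsWithin_le_nhds).and self_mem_nhdsWithin
  obtain ⟨z, ⟨hzV, hz⟩, hne⟩ := hev.exists
  exact hne (hinj hzV (mem_of_mem_nhds hV) (hz.trans hs.self_of_nhds.symm))

theorem not_eventually_deriv_eq_zero {f : ℂ → ℂ} {ζ : ℂ} (hf : AnalyticAt ℂ f ζ)
    (hc : ∀ c, ¬ ∀ᶠ z in 𝓝 ζ, f z = c) : ¬ ∀ᶠ z in 𝓝 ζ, deriv f z = 0 := by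
  intro h
  obtain ⟨ε, hε, hball⟩ := Metric.eventually_nhds_iff_ball.1 (h.and hf.eventually_analyticAt)
  refine hc (f ζ) (Filter.eventually_of_mem (Metric.ball_mem_nhds ζ hε) fun z hz ↦ ?_)
  exact Metric.isOpen_ball.is_const_of_deriv_eq_zero (convex_ball ζ ε).isPreconnected
    (fun w hw ↦ (hball w hw).2.differentiableAt.differentiableWithinAt)
    (fun w hw ↦ (hball w hw).1) hz (Metric.mem_ball_self hε)

section

variable {f : ℂ → ℂ}

theorem eventually_norm_logDeriv_deriv_le {ζ : ℂ} (hζ : ζ ∈ exteriorDisk)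
    (hf : MeromorphicAt f ζ)
    (hineq : ∀ ζ ∈ exteriorDisk, ¬ IsPole f ζ →
      (‖ζ‖ ^ 2 - 1) * ‖ζ * deriv (deriv f) ζ / deriv f ζ‖ ≤ 1) :
    ∀ᶠ z in 𝓝[≠] ζ, ‖logDeriv (deriv f) z‖ ≤ 1 / (‖ζ‖ ^ 2 - 1) + 1 := by
  have h1 := mem_exteriorDisk.1 hζ
  have hcont : ContinuousAt (fun z : ℂ ↦ 1 / (‖z‖ ^ 2 - 1)) ζ := by
    refine continuousAt_const.div (by fun_prop) ?_
    nlinarith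
  filter_upwards [hf.eventually_analyticAt,
    nhdsWithin_le_nhds (isOpen_exteriorDisk.mem_nhds hζ),
    nhdsWithin_le_nhds (hcont.eventually_lt continuousAt_const (lt_add_one _))] with z hz hze hzlt
  have hb := hineq z hze hz.not_isPole
  have hz1 := mem_exteriorDisk.1 hze
  have hpos : 0 < ‖z‖ ^ 2 - 1 := by nlinarith
  refine le_trans ?_ hzlt.le
  rw [le_div_iff₀ hpos, logDeriv_apply]
  rw [mul_div_assoc, norm_mul] at hb
  have h0 := norm_nonneg (deriv (deriv f) z / deriv f z)
  nlinarith [mul_nonneg hpos.le h0]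

theorem not_isPole_of_logDeriv_deriv_bounded {ζ : ℂ} {C : ℝ} (hf : MeromorphicAt f ζ)
    (hC : ∀ᶠ z in 𝓝[≠] ζ, ‖logDeriv (deriv f) z‖ ≤ C) : ¬ IsPole f ζ := by
  intro hp
  obtain ⟨n, hn⟩ := WithTop.ne_top_iff_exists.1 (ne_top_of_lt hp)
  obtain ⟨g, hg, hg0, hfg⟩ := (meromorphicOrderAt_eq_int_iff hf).1 hn.symm
  have hn0 : n < 0 := by
    unfold IsPole at hp
    rw [← hn] at hp
    exact_mod_cast hp
  have hm : n - 1 = 0 := by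
    -- If f = (z-ζ)ⁿg, then f' = (z-ζ)ⁿ⁻¹(ng + (z-ζ)g'), whose second factor is n g(ζ) ≠ 0 at ζ; but
    -- n - 1 < 0.
    refine zpow_exponent_eq_zero_of_logDeriv_bounded
      (g := fun z ↦ n * g z + (z - ζ) * deriv g z) ?_ (by simpa using ⟨hn0.ne, hg0⟩) ?_ hC
    · exact (analyticAt_const.mul hg).add ((analyticAt_id.sub analyticAt_const).mul hg.deriv)
    · have hfg' : f =ᶠ[𝓝[≠] ζ] fun z ↦ (z - ζ) ^ n * g z := hfg
      filter_upwards [hfg'.nhdsNE_deriv, self_mem_nhdsWithin,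
        nhdsWithin_le_nhds hg.eventually_analyticAt] with z hz hne hgz
      have hne' : z - ζ ≠ 0 := sub_ne_zero.2 hne
      have hd : HasDerivAt (fun z ↦ (z - ζ) ^ n) (n * (z - ζ) ^ (n - 1)) z := by
        have := (hasDerivAt_zpow n (z - ζ) (Or.inl hne')).comp z ((hasDerivAt_id z).sub_const ζ)
        rwa [mul_one] at this
      refine (hz.trans (hd.mul hgz.differentiableAt.hasDerivAt).deriv).trans ?_
      have : (z - ζ) ^ n = (z - ζ) ^ (n - 1) * (z - ζ) := by
        rw [← zpow_add_one₀ hne', sub_add_cancel]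
      rw [this]
      ring
  omega

/-- At a zero of `deriv f` the quotient is 0 by convention and the bound says nothing, so
nonvanishing is drawn from nearby points. Local univalence serves to exclude local constancy. -/
theorem analyticAt_and_deriv_ne_zero (hf : MeromorphicNFOn f exteriorDisk)
    (hloc : IsLocallyUnivalentOn f exteriorDisk)
    (hineq : ∀ ζ ∈ exteriorDisk, ¬ IsPole f ζ →
      (‖ζ‖ ^ 2 - 1) * ‖ζ * deriv (deriv f) ζ / deriv f ζ‖ ≤ 1)
    {ζ : ℂ} (hζ : ζ ∈ exteriorDisk) : AnalyticAt ℂ f ζ ∧ deriv f ζ ≠ 0 := by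
  have hC := eventually_norm_logDeriv_deriv_le hζ (hf hζ).meromorphicAt hineq
  have han : AnalyticAt ℂ f ζ := (hf hζ).meromorphicOrderAt_nonneg_iff_analyticAt.1
    (not_lt.1 (not_isPole_of_logDeriv_deriv_bounded (hf hζ).meromorphicAt hC))
  exact ⟨han, han.deriv.ne_zero_of_logDeriv_bounded
    (not_eventually_deriv_eq_zero han (hloc.not_eventuallyEq_const hζ)) hC⟩

/-! ### Passage to the variable 1/ζ and the weak criterion -/

/-- An expansion `f ζ = b ζ + c₀ + c₁ / ζ + ⋯` at infinity of a function analytic in the exterior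
disk amounts to `f ζ = b ζ + h (1 / ζ)` with `h` holomorphic in the unit disk. -/
theorem exists_holomorphic_part (hf : ∀ ζ ∈ exteriorDisk, AnalyticAt ℂ f ζ) {b : ℂ} {c : ℕ → ℂ}
    {R : ℝ} (hsum : ∀ ζ : ℂ, R < ‖ζ‖ → HasSum (fun n : ℕ ↦ c n / ζ ^ n) (f ζ - b * ζ)) :
    ∃ h : ℂ → ℂ, DifferentiableOn ℂ h (Metric.ball 0 1) ∧
      ∀ ζ ∈ exteriorDisk, f ζ = b * ζ + h ζ⁻¹ := by
  classical
  -- Since `0⁻¹ = 0`, the formula is meaningless at 0; `c 0` is the constant term of the expansion.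
  refine ⟨Function.update (fun z ↦ f z⁻¹ - b * z⁻¹) 0 (c 0), fun z hz ↦ ?_, fun ζ hζ ↦ ?_⟩
  · refine DifferentiableAt.differentiableWithinAt ?_
    rcases eq_or_ne z 0 with rfl | hz0
    · have : HasFPowerSeriesAt (Function.update (fun z ↦ f z⁻¹ - b * z⁻¹) 0 (c 0))
          (FormalMultilinearSeries.ofScalars ℂ c) 0 := by
        rw [hasFPowerSeriesAt_iff]
        have hinv : ∀ᶠ z : ℂ in 𝓝 0, ‖z‖ < 1 / (|R| + 1) := by
          have : (0 : ℝ) < 1 / (|R| + 1) := by positivity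
          filter_upwards [Metric.ball_mem_nhds (0 : ℂ) this] with z hz
          exact mem_ball_zero_iff.1 hz
        filter_upwards [hinv] with z hz
        rcases eq_or_ne z 0 with rfl | hz0
        · have := hasSum_single (f := fun n : ℕ ↦ (0 : ℂ) ^ n • c n) 0
            (fun n hn ↦ by simp [hn])
          simpa [FormalMultilinearSeries.coeff_ofScalars] using this
        · have hR : R < ‖z⁻¹‖ := by
            rw [norm_inv]
            have hzp : 0 < ‖z‖ := norm_pos_iff.2 hz0
            have : |R| + 1 < ‖z‖⁻¹ := by
              rw [lt_inv_comm₀ (by positivity) hzp]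
              simpa using hz
            linarith [le_abs_self R]
          simpa [FormalMultilinearSeries.coeff_ofScalars, hz0, div_eq_mul_inv, mul_comm]
            using hsum z⁻¹ hR
      exact this.analyticAt.differentiableAt
    · have hd : DifferentiableAt ℂ (fun z ↦ f z⁻¹ - b * z⁻¹) z := by
        have := (hf z⁻¹ (inv_mem_exteriorDisk hz0 (by simpa using hz))).differentiableAt
        have hi : DifferentiableAt ℂ (fun z : ℂ ↦ z⁻¹) z := differentiableAt_inv hz0
        exact (this.comp z hi).sub (hi.const_mul b)
      refine hd.congr_of_eventuallyEq ?_
      filter_upwards [eventually_ne_nhds hz0] with w hw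
      simp [hw]
  · have : ζ ≠ 0 := by
      rintro rfl
      have := mem_exteriorDisk.1 hζ
      simp at this
      linarith
    simp [this]

/-- Becker's criterion for `b w + h (1 / w)`, `1 < ‖w‖`. -/
theorem injOn_of_becker {b : ℂ} {h : ℂ → ℂ} (hh : DifferentiableOn ℂ h (Metric.ball 0 1))
    (hne : ∀ z : ℂ, ‖z‖ < 1 → b - z ^ 2 * deriv h z ≠ 0)
    (hle : ∀ z : ℂ, ‖z‖ < 1 →
      (1 - ‖z‖ ^ 2) * ‖2 * deriv h z + z * deriv (deriv h) z‖ ≤ ‖b - z ^ 2 * deriv h z‖) :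
    Set.InjOn (fun ζ ↦ b * ζ + h ζ⁻¹) {ζ : ℂ | 1 < ‖ζ‖} := by
  intro ζ₁ hζ₁ ζ₂ hζ₂ heq
  -- With r = 1/q, both rζ₁ and rζ₂ stay in |w| ≥ 1, while h(rz) is holomorphic in |z| < q.
  obtain ⟨q, hq1, hq⟩ : ∃ q : ℝ, 1 < q ∧ q ≤ min ‖ζ₁‖ ‖ζ₂‖ := ⟨_, lt_min hζ₁ hζ₂, le_rfl⟩
  set r : ℝ := q⁻¹ with hr
  have hr0 : 0 < r := by positivity
  have hr1 : r < 1 := inv_lt_one_of_one_lt₀ hq1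
  have hrc : (r : ℂ) ≠ 0 := by exact_mod_cast hr0.ne'
  have hnorm : ∀ z : ℂ, ‖(r : ℂ) * z‖ = r * ‖z‖ := fun z ↦ by
    rw [norm_mul, Complex.norm_real, Real.norm_of_nonneg hr0.le]
  have hmaps : Set.MapsTo (fun z : ℂ ↦ (r : ℂ) * z) (Metric.ball 0 q) (Metric.ball 0 1) := by
    intro z hz
    have : ‖z‖ < q := by simpa using hz
    rw [mem_ball_zero_iff, hnorm, hr, inv_mul_lt_iff₀ (by linarith)]
    simpa using this
  have hd1 : deriv (fun z ↦ h (r * z)) = fun z ↦ r * deriv h (r * z) := by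
    ext z
    simpa using deriv_comp_mul_left (r : ℂ) h z
  have hd2 : deriv (deriv fun z ↦ h (r * z)) = fun z ↦ r * (r * deriv (deriv h) (r * z)) := by
    rw [hd1]
    ext z
    rw [deriv_const_mul_field]
    exact congrArg _ (deriv_comp_mul_left (r : ℂ) (deriv h) z)
  -- Strictness comes from 1 - |z|² acquiring a factor r²: r² - |rz|² < 1 - |rz|².
  have key := injOn_of_becker_strict (b := b / r) (h := fun z ↦ h (r * z)) hq1
    (hh.comp (by fun_prop) hmaps) (fun z hz ↦ by
      have hrz : ‖(r : ℂ) * z‖ < 1 := by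
        rw [hnorm]
        nlinarith [norm_nonneg z]
      have h1 := hle _ hrz
      have h2 : 0 < ‖b - (r * z) ^ 2 * deriv h (r * z)‖ := norm_pos_iff.2 (hne _ hrz)
      rw [hd2, hd1]
      have e1 : 2 * (r * deriv h (r * z)) + z * (r * (r * deriv (deriv h) (r * z))) =
          r * (2 * deriv h (r * z) + r * z * deriv (deriv h) (r * z)) := by ring
      have e2 : b / r - z ^ 2 * (r * deriv h (r * z)) =
          (r : ℂ)⁻¹ * (b - (r * z) ^ 2 * deriv h (r * z)) := by
        field_simp
      simp only
      rw [e1, e2, hnorm, norm_mul, norm_inv, Complex.norm_real, Real.norm_of_nonneg hr0.le,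
        lt_inv_mul_iff₀ hr0]
      rw [hnorm] at h1
      set X := ‖2 * deriv h (r * z) + r * z * deriv (deriv h) (r * z)‖
      have hX : 0 ≤ X := norm_nonneg _
      have hr2 : r ^ 2 < 1 := by nlinarith
      rcases hX.eq_or_lt with hX0 | hX0
      · rw [← hX0]
        simpa using h2
      · calc r * ((1 - ‖z‖ ^ 2) * (r * X)) = (r ^ 2 - (r * ‖z‖) ^ 2) * X := by ring
          _ < (1 - (r * ‖z‖) ^ 2) * X := by gcongr
          _ ≤ _ := h1)
  have hmem : ∀ ζ : ℂ, q ≤ ‖ζ‖ → (r : ℂ) * ζ ∈ {w : ℂ | 1 ≤ ‖w‖} := fun ζ hζ ↦ by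
    rw [Set.mem_ofPred_eq, hnorm, hr, le_inv_mul_iff₀ (by linarith)]
    simpa using hζ
  have hval : ∀ ζ : ℂ, b / r * (r * ζ) + h (r * (r * ζ)⁻¹) = b * ζ + h ζ⁻¹ := fun ζ ↦ by
    rw [mul_inv, mul_inv_cancel_left₀ hrc, div_mul_eq_mul_div, mul_left_comm,
      mul_div_cancel_left₀ _ hrc]
  have := key (hmem ζ₁ (hq.trans (min_le_left _ _))) (hmem ζ₂ (hq.trans (min_le_right _ _)))
    (by simpa only [hval] using heq)
  exact mul_left_cancel₀ hrc this

theorem deriv_and_deriv_deriv_of_holomorphic_part {b : ℂ} {h : ℂ → ℂ}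
    (hh : DifferentiableOn ℂ h (Metric.ball 0 1))
    (hfh : ∀ ζ ∈ exteriorDisk, f ζ = b * ζ + h ζ⁻¹) {z : ℂ} (hz0 : z ≠ 0) (hz : ‖z‖ < 1) :
    deriv f z⁻¹ = b - z ^ 2 * deriv h z ∧
      deriv (deriv f) z⁻¹ = z ^ 3 * (2 * deriv h z + z * deriv (deriv h) z) := by
  have hd : ∀ ζ ∈ exteriorDisk, ζ ≠ 0 ∧ HasDerivAt h (deriv h ζ⁻¹) ζ⁻¹ ∧
      HasDerivAt (deriv h) (deriv (deriv h) ζ⁻¹) ζ⁻¹ := fun ζ hζ ↦ by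
    have h1 := mem_exteriorDisk.1 hζ
    have hb : Metric.ball (0 : ℂ) 1 ∈ 𝓝 ζ⁻¹ :=
      Metric.isOpen_ball.mem_nhds (by simpa using inv_lt_one_of_one_lt₀ h1)
    exact ⟨norm_pos_iff.1 (by linarith), (hh.differentiableAt hb).hasDerivAt,
      ((hh.deriv Metric.isOpen_ball).differentiableAt hb).hasDerivAt⟩
  have hf1 : ∀ ζ ∈ exteriorDisk, deriv f ζ = b - (ζ⁻¹) ^ 2 * deriv h ζ⁻¹ := fun ζ hζ ↦ by
    obtain ⟨h0, h1, -⟩ := hd ζ hζ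
    have he : f =ᶠ[𝓝 ζ] fun ζ ↦ b * ζ + h ζ⁻¹ :=
      Filter.eventually_of_mem (isOpen_exteriorDisk.mem_nhds hζ) hfh
    rw [he.deriv_eq]
    have e := ((hasDerivAt_id ζ).const_mul b).add (h1.comp ζ (hasDerivAt_inv h0))
    refine e.deriv.trans ?_
    rw [inv_pow]
    ring
  have hζ := inv_mem_exteriorDisk hz0 hz
  obtain ⟨h0, -, h2⟩ := hd _ hζ
  refine ⟨by simpa using hf1 _ hζ, ?_⟩
  have he : deriv f =ᶠ[𝓝 z⁻¹] fun ζ ↦ b - (ζ⁻¹) ^ 2 * deriv h ζ⁻¹ :=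
    Filter.eventually_of_mem (isOpen_exteriorDisk.mem_nhds hζ) hf1
  rw [he.deriv_eq]
  have e := (((hasDerivAt_inv h0).pow 2).mul (h2.comp z⁻¹ (hasDerivAt_inv h0))).const_sub b
  refine e.deriv.trans ?_
  simp
  ring

end

/-! ### The criterion on the exterior disk -/

theorem corollaryc4 (f : ℂ → ℂ) (hf : f ∈ ClassSigma)
    (hloc : IsLocallyUnivalentOn f exteriorDisk)
    (hineq : ∀ ζ ∈ exteriorDisk, ¬ IsPole f ζ →
      (‖ζ‖ ^ 2 - 1) * ‖ζ * deriv (deriv f) ζ / deriv f ζ‖ ≤ 1) :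
    IsUnivalentOn f exteriorDisk := by
  obtain ⟨hNF, b, c, R, hsum⟩ := hf
  have han : ∀ ζ ∈ exteriorDisk, AnalyticAt ℂ f ζ := fun ζ hζ ↦
    (analyticAt_and_deriv_ne_zero hNF hloc hineq hζ).1
  obtain ⟨h, hh, hfh⟩ := exists_holomorphic_part han hsum
  have hh1 := hh.deriv Metric.isOpen_ball
  have hh2 := hh1.deriv Metric.isOpen_ball
  have h0mem : Metric.ball (0 : ℂ) 1 ∈ 𝓝 0 := Metric.ball_mem_nhds 0 one_pos
  have hne' : ∀ z : ℂ, z ≠ 0 → ‖z‖ < 1 → b - z ^ 2 * deriv h z ≠ 0 := fun z hz0 hz ↦ by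
    rw [← (deriv_and_deriv_deriv_of_holomorphic_part hh hfh hz0 hz).1]
    exact (analyticAt_and_deriv_ne_zero hNF hloc hineq (inv_mem_exteriorDisk hz0 hz)).2
  have hle' : ∀ z : ℂ, z ≠ 0 → ‖z‖ < 1 →
      (1 - ‖z‖ ^ 2) * ‖2 * deriv h z + z * deriv (deriv h) z‖ ≤ ‖b - z ^ 2 * deriv h z‖ := by
    intro z hz0 hz
    have hζ := inv_mem_exteriorDisk hz0 hz
    have h1 := hineq _ hζ (han _ hζ).not_isPole
    obtain ⟨e1, e2⟩ := deriv_and_deriv_deriv_of_holomorphic_part hh hfh hz0 hz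
    have hpos : 0 < ‖b - z ^ 2 * deriv h z‖ := norm_pos_iff.2 (hne' z hz0 hz)
    have hzp : 0 < ‖z‖ := norm_pos_iff.2 hz0
    rw [e1, e2, norm_div, norm_mul, norm_mul, norm_pow, norm_inv, ← mul_div_assoc,
      div_le_one hpos] at h1
    refine le_trans (le_of_eq ?_) h1
    field_simp
  have hu : AnalyticAt ℂ (fun z ↦ b - z ^ 2 * deriv h z) 0 :=
    analyticAt_const.sub ((analyticAt_id.pow 2).mul (hh1.analyticAt h0mem))
  have hud : ∀ z : ℂ, ‖z‖ < 1 → deriv (fun z ↦ b - z ^ 2 * deriv h z) z =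
      -(z * (2 * deriv h z + z * deriv (deriv h) z)) := fun z hz ↦ by
    have h1 := (hh1.differentiableAt (Metric.isOpen_ball.mem_nhds
      (mem_ball_zero_iff.2 hz))).hasDerivAt
    refine (((hasDerivAt_pow 2 z).mul h1).const_sub b).deriv.trans ?_
    simp
    ring
  -- The point z = 0, that is ζ = ∞, is treated like a possible critical point: u = b - z²h'
  -- satisfies |u'/u| ≤ |z|/(1-|z|²) ≤ 2 for 0 < |z| < 1/2.
  have hb : b ≠ 0 := by
    have hu0 := hu.ne_zero_of_logDeriv_bounded (C := 2) ?_ ?_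
    · simpa using hu0
    · intro hev
      have hev' : ∀ᶠ z in 𝓝[≠] (0 : ℂ),
          (b - z ^ 2 * deriv h z = 0 ∧ z ∈ Metric.ball (0 : ℂ) 1) ∧ z ≠ 0 :=
        ((hev.and h0mem).filter_mono nhdsWithin_le_nhds).and self_mem_nhdsWithin
      obtain ⟨z, ⟨hz, hz1⟩, hz0⟩ := hev'.exists
      exact hne' z hz0 (mem_ball_zero_iff.1 hz1) hz
    · filter_upwards [nhdsWithin_le_nhds (Metric.ball_mem_nhds (0 : ℂ) one_half_pos),
        self_mem_nhdsWithin] with z hz hz0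
      have hz2 : ‖z‖ < 1 / 2 := mem_ball_zero_iff.1 hz
      have hz1 : ‖z‖ < 1 := by linarith
      have h1 := hle' z hz0 hz1
      rw [logDeriv_apply, hud z hz1, norm_div, norm_neg, norm_mul,
        div_le_iff₀ (norm_pos_iff.2 (hne' z hz0 hz1))]
      have h2 : 0 ≤ 2 * (1 - ‖z‖ ^ 2) - ‖z‖ := by nlinarith [norm_nonneg z]
      nlinarith [mul_nonneg h2 (norm_nonneg (2 * deriv h z + z * deriv (deriv h) z))]
  -- The hypothesis does not reach ζ = ∞; continuity supplies the inequality there.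
  have hle0 : (1 - ‖(0 : ℂ)‖ ^ 2) * ‖2 * deriv h 0 + 0 * deriv (deriv h) 0‖ ≤
      ‖b - 0 ^ 2 * deriv h 0‖ := by
    have hc1 := (hh1.differentiableAt h0mem).continuousAt
    have hc2 := (hh2.differentiableAt h0mem).continuousAt
    have hl : ContinuousAt (fun z : ℂ ↦
        (1 - ‖z‖ ^ 2) * ‖2 * deriv h z + z * deriv (deriv h) z‖) 0 := by fun_prop
    have hr : ContinuousAt (fun z : ℂ ↦ ‖b - z ^ 2 * deriv h z‖) 0 := by fun_prop
    refine le_of_tendsto_of_tendsto (hl.tendsto.mono_left nhdsWithin_le_nhds)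
      (hr.tendsto.mono_left nhdsWithin_le_nhds) (b := 𝓝[≠] (0 : ℂ)) ?_
    filter_upwards [nhdsWithin_le_nhds h0mem, self_mem_nhdsWithin] with z hz hz0
    exact hle' z hz0 (mem_ball_zero_iff.1 hz)
  have hinj := injOn_of_becker (b := b) hh
    (fun z hz ↦ by
      rcases eq_or_ne z 0 with rfl | hz0
      · simpa using hb
      · exact hne' z hz0 hz)
    (fun z hz ↦ by
      rcases eq_or_ne z 0 with rfl | hz0
      · exact hle0
      · exact hle' z hz0 hz)
  intro ζ₁ hζ₁ ζ₂ hζ₂ heq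
  rw [toSphere_of_not_isPole (han _ hζ₁).not_isPole,
    toSphere_of_not_isPole (han _ hζ₂).not_isPole] at heq
  have heq' := OnePoint.coe_injective heq
  rw [hfh _ hζ₁, hfh _ hζ₂] at heq'
  exact hinj (mem_exteriorDisk.1 hζ₁) (mem_exteriorDisk.1 hζ₂) heq'
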